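/- Let $R$ be a commutative noetherian ring, $\mathfrak a$ an ideal of $R$, $M$ an $R$-module and $n\ge 0$ an integer. Write $H^i_{\mathfrak a}(M)\cong\varinjlim_t\operatorname{Ext}^i_R(R/\mathfrak a^t,M)$ for the $i$-th local cohomology module of $M$ with support in $\mathfrak a$. An $R$-module $N$ is called weakly Laskerian if every quotient module of $N$ has only finitely many associated primes. A Serre subcategory of $R$-modules is a full subcategory that contains the zero module and is closed under submodules, quotients and extensions (hence under isomorphisms). (a) If $H^i_{\mathfrak a}(M)$ is weakly Laskerian for all $0\le i\le n$, then $\operatorname{Ext}^i_R(R/\mathfrak a,M)$ is weakly Laskerian for all $0\le i\le n$. (b) More generally, let $\mathcal S$ be any Serre subcategory of $R$-modules. If $H^i_{\mathfrak a}(M)\in\mathcal S$ for all $0\le i\le n$, then $\operatorname{Ext}^i_R(R/\mathfrak a,M)\in\mathcal S$ for all $0\le i\le n$. (c) Suppose that $\operatorname{Ext}^1_R(R/\mathfrak a,K)$ is weakly Laskerian for every $0\le i\le n$ and every proper submodule $K$ of $H^i_{\mathfrak a}(M)$. If $\operatorname{Ext}^i_R(R/\mathfrak a,M)$ is weakly Laskerian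 for all $0\le i\le n$, then $H^i_{\mathfrak a}(M)$ is weakly Laskerian for all $0\le i\le n$. -/

import Mathlib

universe u

open CategoryTheory

/-- A module `M` over `R` is weakly Laskerian if every quotient module of `M` has only finitely
many associated primes. -/
def IsWeaklyLaskerian (R : Type u) [CommRing R] (M : Type u) [AddCommGroup M] [Module R M] :
    Prop :=
  ∀ N : Submodule R M, (associatedPrimes R (M ⧸ N)).Finite

/-- The full subcategory of weakly Laskerian `R`-modules. -/
def weaklyLaskerian (R : Type u) [CommRing R] : ObjectProperty (ModuleCat.{u} R) :=
  fun M => IsWeaklyLaskerian R M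

/-- The `R`-module `Ext^i_R(R/𝔞, M)`. -/
noncomputable def extQuotient {R : Type u} [CommRing R] (𝔞 : Ideal R) (i : ℕ)
    (M : ModuleCat.{u} R) : ModuleCat.{u} R :=
  ((Ext R (ModuleCat.{u} R) i).obj (Opposite.op (ModuleCat.of R (R ⧸ 𝔞)))).obj M

/-! All three parts rest on one equivalence, `prop_extModule_iff_prop_hom_extColim`: if `H^i_𝔞(M)`
lies in a Serre class `S` for all `i < n`, then `Ext^n(R/𝔞, M) ∈ S` if and only if `Hom(R/𝔞,
H^n_𝔞(M)) ∈ S`. For `n = 0` both sides are `Hom(R/𝔞, M)`, since `H^0_𝔞(M)` is the torsion submodule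
`Γ(M)` and maps from `R/𝔞` land there. For `n + 1`, dividing by `Γ(M) = H^0_𝔞(M) ∈ S` changes `Ext`
only modulo `S` and leaves local cohomology in positive degrees unchanged. The torsion-free `M/Γ(M)`
embeds in a torsion-free injective `E`, and every `Ext` from a torsion module to `E` vanishes, in
degree 0 too. So passing to the cokernel lowers both `Ext` and local cohomology by one degree.
Noetherianity enters through Artin–Rees: `Γ` of an injective is injective, so torsion modules have
no higher local cohomology.

Part (b) follows because `Hom(R/𝔞, -)` preserves `S`, and (a) because weakly Laskerian modules form
a Serre class. For (c), let `H = H^i_𝔞(M)`. By induction on `i` the equivalence makes `Hom(R/𝔞, H)`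
weakly Laskerian. For `K` proper in `H`, `Hom(R/𝔞, H/K)` sits between it and `Ext^1(R/𝔞, K)`, and it
detects every associated prime of the torsion module `H/K`. -/

section ExtComparison

open Limits Opposite

/-! ### Comparing left-derived `Ext` with derived-category `Ext`, via cocycles. -/

namespace HomologicalComplex

variable {R : Type*} [Ring R] {ι : Type*} {c : ComplexShape ι}
  (K : HomologicalComplex (ModuleCat R) c)

lemma moduleCat_homologyπ_eq_zero_iff {m n : ι} (hm : c.prev n = m) (x : K.cycles n) :
    K.homologyπ n x = 0 ↔ ∃ y : K.X m, K.d m n y = K.iCycles n x := by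
  have h := ShortComplex.exact_of_g_is_cokernel
    (ShortComplex.mk (K.toCycles m n) (K.homologyπ n) (by simp)) (K.homologyIsCokernel m n hm)
  rw [ShortComplex.moduleCat_exact_iff] at h
  have hi : Function.Injective (K.iCycles n) :=
    (ModuleCat.mono_iff_injective _).1 inferInstance
  constructor
  · intro hx
    obtain ⟨y, hy⟩ := h x hx
    refine ⟨y, ?_⟩
    rw [← K.toCycles_i m n, ModuleCat.comp_apply]
    exact congrArg _ hy
  · rintro ⟨y, hy⟩
    have : K.toCycles m n y = x := hi (by rw [← hy, ← ModuleCat.comp_apply, K.toCycles_i])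
    rw [← this, ← ModuleCat.comp_apply, K.toCycles_comp_homologyπ]
    rfl

lemma moduleCat_exists_cycle (n m : ι) (hm : c.next n = m) (x : K.X n) (hx : K.d n m x = 0) :
    ∃ y : K.cycles n, K.iCycles n y = x := by
  have h := ShortComplex.exact_of_f_is_kernel
    (ShortComplex.mk (K.iCycles n) (K.d n m) (by simp)) (K.cyclesIsKernel n m hm)
  rw [ShortComplex.moduleCat_exact_iff] at h
  exact h x hx

lemma moduleCat_d_iCycles (n m : ι) (x : K.cycles n) : K.d n m (K.iCycles n x) = 0 := by
  rw [← ModuleCat.comp_apply, K.iCycles_d]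
  rfl

end HomologicalComplex

namespace CategoryTheory.ProjectiveResolution

universe v w u' t

variable {C : Type u'} [Category.{v} C] [Abelian C] {X Y : C} (P : ProjectiveResolution X)

/-- A degree zero cocycle represents the zero class only if it is zero. -/
lemma extMk_zero_eq_zero_iff [HasExt.{w} C] (f : P.complex.X 0 ⟶ Y)
    (hf : P.complex.d 1 0 ≫ f = 0) : P.extMk f 1 rfl hf = 0 ↔ f = 0 := by
  refine ⟨fun h ↦ ?_, fun h ↦ by subst h; simp⟩
  rw [← P.extEquivCohomologyClass.apply_eq_iff_eq, extEquivCohomologyClass_extMk,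
    extEquivCohomologyClass_zero, CochainComplex.HomComplex.CohomologyClass.mk_eq_zero_iff,
    CochainComplex.HomComplex.Cocycle.toSingleMk_mem_coboundaries_iff _ _ _ _ _ 1 (by simp)] at h
  obtain ⟨g, hg⟩ := h
  -- The cobounding map starts in cohomological degree 1, where the resolution is zero.
  have : g = 0 := (CochainComplex.isZero_of_isStrictlyLE P.cochainComplex 0 1).eq_of_src _ _
  rw [this, comp_zero] at hg
  rw [← cancel_epi (P.cochainComplexXIso (-((0 : ℕ) : ℤ)) 0 rfl).hom, ← hg, comp_zero]

/-- In `ComplexShape.up ℕ` the predecessor of 0 is 0 itself, with zero differential, so one formula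
covers both cases. -/
lemma extMk_eq_zero_iff_prev [HasExt.{w} C] {n : ℕ} (f : P.complex.X n ⟶ Y)
    (hf : P.complex.d (n + 1) n ≫ f = 0) :
    P.extMk f (n + 1) rfl hf = 0 ↔
      ∃ g : P.complex.X ((ComplexShape.up ℕ).prev n) ⟶ Y, P.complex.d n _ ≫ g = f := by
  cases n with
  | zero =>
    rw [extMk_zero_eq_zero_iff, P.complex.shape _ _ (by simp)]
    simp [eq_comm]
  | succ k =>
    rw [P.extMk_eq_zero_iff f _ rfl hf k rfl, CochainComplex.prev_nat_succ]

variable (R : Type t) [CommRing R] [Linear R C]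

lemma smul_extMk [HasExt.{w} C] {n : ℕ} (f : P.complex.X n ⟶ Y)
    (hf : P.complex.d (n + 1) n ≫ f = 0) (r : R) :
    r • P.extMk f (n + 1) rfl hf = P.extMk (r • f) (n + 1) rfl (by simp [hf]) := by
  rw [Abelian.Ext.smul_eq_comp_mk₀, extMk_comp_mk₀]
  simp

variable (Y)

/-- The morphism underlying a cocycle of `Hom(P, Y)`. -/
noncomputable def cocycleHom (n : ℕ) :
    (P.complex.linearYonedaObj R Y).cycles n →ₗ[R] (P.complex.X n ⟶ Y) :=
  ((P.complex.linearYonedaObj R Y).iCycles n).hom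

lemma d_comp_cocycleHom (n : ℕ) (x : (P.complex.linearYonedaObj R Y).cycles n) :
    P.complex.d (n + 1) n ≫ P.cocycleHom Y R n x = 0 :=
  (P.complex.linearYonedaObj R Y).moduleCat_d_iCycles n (n + 1) x

/-- A cocycle of `Hom(P, Y)` has a class in `Ext X Y n`. -/
noncomputable def cyclesToExt [HasExt.{w} C] (n : ℕ) :
    (P.complex.linearYonedaObj R Y).cycles n →ₗ[R] Abelian.Ext X Y n where
  toFun x := P.extMk (P.cocycleHom Y R n x) (n + 1) rfl (P.d_comp_cocycleHom Y R n x)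
  map_add' x y := by
    simp only [P.add_extMk, map_add]
  map_smul' r x := by
    simp only [RingHom.id_apply, P.smul_extMk R, map_smul]

lemma cyclesToExt_surjective [HasExt.{w} C] (n : ℕ) :
    Function.Surjective (P.cyclesToExt Y R n) := fun x ↦ by
  obtain ⟨f, hf, rfl⟩ := P.extMk_surjective x (n + 1) rfl
  obtain ⟨y, hy⟩ := (P.complex.linearYonedaObj R Y).moduleCat_exists_cycle n (n + 1) (by simp) f hf
  have hy' : P.cocycleHom Y R n y = f := hy
  subst hy'
  exact ⟨y, rfl⟩

lemma ker_cyclesToExt [HasExt.{w} C] (n : ℕ) :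
    LinearMap.ker (P.cyclesToExt Y R n) =
      LinearMap.ker ((P.complex.linearYonedaObj R Y).homologyπ n).hom := by
  ext x
  rw [LinearMap.mem_ker, LinearMap.mem_ker]
  exact (P.extMk_eq_zero_iff_prev _ (P.d_comp_cocycleHom Y R n x)).trans
    ((P.complex.linearYonedaObj R Y).moduleCat_homologyπ_eq_zero_iff rfl x).symm

variable [EnoughProjectives C]

/-- The class in `Ext R C n` of a cocycle of `Hom(P, Y)`. -/
noncomputable def cyclesToLeftDerivedExt (n : ℕ) :
    (P.complex.linearYonedaObj R Y).cycles n →ₗ[R] ((Ext R C n).obj (op X)).obj Y :=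
  ((P.complex.linearYonedaObj R Y).homologyπ n ≫ (P.isoExt n Y).inv).hom

lemma cyclesToLeftDerivedExt_surjective (n : ℕ) :
    Function.Surjective (P.cyclesToLeftDerivedExt Y R n) :=
  (ModuleCat.epi_iff_surjective _).1 inferInstance

lemma ker_cyclesToLeftDerivedExt [HasExt.{w} C] (n : ℕ) :
    LinearMap.ker (P.cyclesToLeftDerivedExt Y R n) = LinearMap.ker (P.cyclesToExt Y R n) := by
  rw [ker_cyclesToExt]
  ext x
  rw [LinearMap.mem_ker, LinearMap.mem_ker]
  exact map_eq_zero_iff (P.isoExt (R := R) n Y).inv.hom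
    ((ModuleCat.mono_iff_injective (P.isoExt (R := R) n Y).inv).1 inferInstance)

/-- The comparison between `Ext` defined by left deriving `Hom` in the first variable and `Ext`
defined through the derived category. -/
noncomputable def leftDerivedExtEquiv [HasExt.{w} C] (n : ℕ) :
    ((Ext R C n).obj (op X)).obj Y ≃ₗ[R] Abelian.Ext X Y n :=
  ((P.cyclesToLeftDerivedExt Y R n).quotKerEquivOfSurjective
    (P.cyclesToLeftDerivedExt_surjective Y R n)).symm ≪≫ₗ
  Submodule.quotEquivOfEq _ _ (P.ker_cyclesToLeftDerivedExt Y R n) ≪≫ₗ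
  (P.cyclesToExt Y R n).quotKerEquivOfSurjective (P.cyclesToExt_surjective Y R n)

lemma leftDerivedExtEquiv_apply [HasExt.{w} C] (n : ℕ)
    (x : (P.complex.linearYonedaObj R Y).cycles n) :
    P.leftDerivedExtEquiv Y R n (P.cyclesToLeftDerivedExt Y R n x) = P.cyclesToExt Y R n x := by
  have : ((P.cyclesToLeftDerivedExt Y R n).quotKerEquivOfSurjective
      (P.cyclesToLeftDerivedExt_surjective Y R n)).symm (P.cyclesToLeftDerivedExt Y R n x) =
      Submodule.Quotient.mk x := by
    rw [LinearEquiv.symm_apply_eq]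
    rfl
  rw [leftDerivedExtEquiv, LinearEquiv.trans_apply, LinearEquiv.trans_apply, this]
  rfl

variable {X' : C} {P} {P' : ProjectiveResolution X'} {g : X' ⟶ X} (φ : Hom P' P g)

/-- The map of cochain complexes `Hom(P, Y) ⟶ Hom(P', Y)` induced by `P' ⟶ P`. -/
noncomputable def linearYonedaMap :
    P.complex.linearYonedaObj R Y ⟶ P'.complex.linearYonedaObj R Y :=
  ((HomologicalComplex.unopFunctor _ _).map
    ((((linearYoneda R C).obj Y).rightOp.mapHomologicalComplex _).map φ.hom).op)

lemma isoExt_inv_naturality (n : ℕ) :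
    (P.isoExt n Y).inv ≫ ((Ext R C n).map g.op).app Y =
      HomologicalComplex.homologyMap (linearYonedaMap Y R φ) n ≫ (P'.isoExt n Y).inv := by
  have h0 : φ.hom.f 0 ≫ P.π.f 0 = P'.π.f 0 ≫ g := by
    rw [φ.hom_f_zero_comp_π_f_zero, ChainComplex.single₀_map_f_zero]
    rfl
  have h1 := congrArg Quiver.Hom.unop (isoLeftDerivedObj_hom_naturality g P' P φ.hom h0
    ((linearYoneda R C).obj Y).rightOp n)
  have h2 := congrArg Quiver.Hom.unop
    (HomologicalComplex.homologyOp_hom_naturality (linearYonedaMap Y R φ) n)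
  change ((HomologicalComplex.homologyUnop _ n).hom ≫ (P.isoLeftDerivedObj _ n).hom.unop) ≫
    ((((linearYoneda R C).obj Y).rightOp.leftDerived n).map g).unop = _ ≫
    ((HomologicalComplex.homologyUnop _ n).hom ≫ (P'.isoLeftDerivedObj _ n).hom.unop)
  rw [Category.assoc]
  refine (congrArg _ h1).trans ?_
  exact (Category.assoc _ _ _).symm.trans
    ((congrArg
      (· ≫ (P'.isoLeftDerivedObj ((linearYoneda R C).obj Y).rightOp n).hom.unop) h2).trans
        (Category.assoc _ _ _))

include φ in
-- Checked on cocycles, where both sides are precomposition with the lift `φ` of `g`. This matches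
-- the transition maps of the two direct systems.
lemma leftDerivedExtEquiv_naturality [HasExt.{w} C] (n : ℕ) (x : ((Ext R C n).obj (op X)).obj Y) :
    P'.leftDerivedExtEquiv Y R n (((Ext R C n).map g.op).app Y x) =
      (Abelian.Ext.mk₀ g).comp (P.leftDerivedExtEquiv Y R n x) (zero_add n) := by
  obtain ⟨x, rfl⟩ := P.cyclesToLeftDerivedExt_surjective Y R n x
  have h : ((Ext R C n).map g.op).app Y (P.cyclesToLeftDerivedExt Y R n x) =
      P'.cyclesToLeftDerivedExt Y R n
        (HomologicalComplex.cyclesMap (linearYonedaMap Y R φ) n x) := by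
    change ((P.complex.linearYonedaObj R Y).homologyπ n ≫ (P.isoExt n Y).inv ≫
      ((Ext R C n).map g.op).app Y).hom x = _
    rw [isoExt_inv_naturality, HomologicalComplex.homologyπ_naturality_assoc]
    rfl
  have h' : P'.cocycleHom Y R n (HomologicalComplex.cyclesMap (linearYonedaMap Y R φ) n x) =
      φ.hom.f n ≫ P.cocycleHom Y R n x :=
    congr($(HomologicalComplex.cyclesMap_i (linearYonedaMap Y R φ) n) x)
  rw [h, leftDerivedExtEquiv_apply, leftDerivedExtEquiv_apply]
  refine Eq.trans ?_ (mk₀_comp_extMk _ _ rfl (P.d_comp_cocycleHom Y R n x) φ).symm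
  change P'.extMk _ _ rfl (P'.d_comp_cocycleHom Y R n _) = _
  congr 1

end CategoryTheory.ProjectiveResolution
end ExtComparison

/-! ### Local cohomology as a colimit of derived-category `Ext` modules. -/

section LocalCohomologyExt

open Limits Opposite Abelian

variable {R : Type u} [CommRing R] (𝔞 : Ideal R)

namespace localCohomology

/-- The inverse system of the modules `R ⧸ 𝔞 ^ t`. -/
noncomputable abbrev quotPow : ℕᵒᵖ ⥤ ModuleCat.{u} R := ringModIdeals (idealPowersDiagram 𝔞)

/-- The projection `R ⧸ 𝔞 ^ s ⟶ R ⧸ 𝔞 ^ t` for `t ≤ s`. -/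
noncomputable abbrev quotPowMap {t s : ℕ} (h : t ≤ s) :
    (quotPow 𝔞).obj (op s) ⟶ (quotPow 𝔞).obj (op t) :=
  (quotPow 𝔞).map (homOfLE h).op

/-- The direct system of the modules `Ext^i(R ⧸ 𝔞 ^ t, M)`. -/
noncomputable def extPow (i : ℕ) (M : ModuleCat.{u} R) : ℕᵒᵖᵒᵖ ⥤ ModuleCat.{u} R where
  obj t := ModuleCat.of R (Abelian.Ext ((quotPow 𝔞).obj t.unop) M i)
  map f := ModuleCat.ofHom
    ((Ext.mk₀ ((quotPow 𝔞).map f.unop)).precompOfLinear R M (zero_add i))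
  map_id t := by
    ext x
    simp
  map_comp f g := by
    ext x
    simp

/-- The morphism of direct systems given by composition with an extension class. -/
noncomputable def extPowMap {i j k : ℕ} {M N : ModuleCat.{u} R} (β : Abelian.Ext M N k)
    (h : i + k = j) : extPow 𝔞 i M ⟶ extPow 𝔞 j N where
  app t := ModuleCat.ofHom (β.postcompOfLinear R ((quotPow 𝔞).obj t.unop) h)
  naturality t s f := by
    ext x
    exact Ext.comp_assoc _ _ _ (zero_add _) h (by lia)

/-- The module `colim_t Ext^i(R ⧸ 𝔞 ^ t, M)`. -/
noncomputable def extColim (i : ℕ) (M : ModuleCat.{u} R) : ModuleCat.{u} R :=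
  colimit (extPow 𝔞 i M)

variable {𝔞}

instance preservesColimit_extPow (i : ℕ) (M : ModuleCat.{u} R) :
    PreservesColimit (extPow 𝔞 i M) (forget (ModuleCat.{u} R)) :=
  have : PreservesFilteredColimitsOfSize.{0, 0} (forget (ModuleCat.{u} R)) :=
    preservesSmallestFilteredColimits_of_preservesFilteredColimits _
  inferInstance

/-- The class in `extColim 𝔞 i M` of an element of `Ext^i(R ⧸ 𝔞 ^ t, M)`. -/
noncomputable def toExtColim {i : ℕ} {M : ModuleCat.{u} R} (t : ℕ) :
    Abelian.Ext ((quotPow 𝔞).obj (op t)) M i →ₗ[R] extColim 𝔞 i M :=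
  (colimit.ι (extPow 𝔞 i M) (op (op t))).hom

variable {i : ℕ} {M : ModuleCat.{u} R}

lemma exists_toExtColim_eq (x : extColim 𝔞 i M) :
    ∃ (t : ℕ) (y : Abelian.Ext ((quotPow 𝔞).obj (op t)) M i), toExtColim t y = x := by
  obtain ⟨t, y, hy⟩ := Concrete.colimit_exists_rep _ x
  exact ⟨t.unop.unop, y, hy⟩

lemma toExtColim_precomp {t s : ℕ} (h : t ≤ s) (x : Abelian.Ext ((quotPow 𝔞).obj (op t)) M i) :
    toExtColim s ((Ext.mk₀ (quotPowMap 𝔞 h)).comp x (zero_add i)) = toExtColim t x :=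
  congr($(colimit.w (extPow 𝔞 i M) (homOfLE h).op.op) x)

lemma toExtColim_eq_zero_iff {t : ℕ} (x : Abelian.Ext ((quotPow 𝔞).obj (op t)) M i) :
    toExtColim t x = 0 ↔
      ∃ (s : ℕ) (h : t ≤ s), (Ext.mk₀ (quotPowMap 𝔞 h)).comp x (zero_add i) = 0 := by
  constructor
  · intro hx
    have h0 : toExtColim t x = toExtColim t (0 : Abelian.Ext ((quotPow 𝔞).obj (op t)) M i) := by
      rw [hx, map_zero]
    obtain ⟨k, f, g, hk⟩ := (Concrete.colimit_rep_eq_iff_exists (extPow 𝔞 i M)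
      (i := op (op t)) (j := op (op t)) x 0).1 h0
    refine ⟨k.unop.unop, f.unop.unop.le, ?_⟩
    rw [map_zero] at hk
    exact hk
  · rintro ⟨s, h, hs⟩
    rw [← toExtColim_precomp h, hs, map_zero]

variable {j k : ℕ} {N : ModuleCat.{u} R}

/-- The map on colimits given by composition with an extension class. -/
noncomputable def extColimMap (β : Abelian.Ext M N k) (h : i + k = j) :
    extColim 𝔞 i M →ₗ[R] extColim 𝔞 j N :=
  (colimMap (extPowMap 𝔞 β h)).hom

lemma extColimMap_toExtColim (β : Abelian.Ext M N k) (h : i + k = j) {t : ℕ}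
    (x : Abelian.Ext ((quotPow 𝔞).obj (op t)) M i) :
    extColimMap β h (toExtColim t x) = toExtColim t (x.comp β h) :=
  congr($(ι_colimMap (extPowMap 𝔞 β h) (op (op t))) x)

/-- Kernel classes need only die after increasing `t`; injectivity at each finite stage would be too
strong a demand for the quotient by a torsion submodule. -/
lemma extColimMap_injective (β : Abelian.Ext M N k) (h : i + k = j)
    (hβ : ∀ (t : ℕ) (x : Abelian.Ext ((quotPow 𝔞).obj (op t)) M i), x.comp β h = 0 →
      ∃ (s : ℕ) (hs : t ≤ s), (Ext.mk₀ (quotPowMap 𝔞 hs)).comp x (zero_add i) = 0) :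
    Function.Injective (extColimMap (𝔞 := 𝔞) β h) := by
  rw [injective_iff_map_eq_zero]
  intro x hx
  obtain ⟨t, x, rfl⟩ := exists_toExtColim_eq x
  rw [extColimMap_toExtColim, toExtColim_eq_zero_iff] at hx
  obtain ⟨s, hs, hx⟩ := hx
  rw [← toExtColim_precomp hs, toExtColim_eq_zero_iff]
  exact hβ s _ (by rw [Ext.comp_assoc _ _ _ (zero_add i) h (by lia), hx])

lemma extColimMap_surjective (β : Abelian.Ext M N k) (h : i + k = j)
    (hβ : ∀ (t : ℕ) (y : Abelian.Ext ((quotPow 𝔞).obj (op t)) N j),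
      ∃ (s : ℕ) (hs : t ≤ s) (x : Abelian.Ext ((quotPow 𝔞).obj (op s)) M i),
        x.comp β h = (Ext.mk₀ (quotPowMap 𝔞 hs)).comp y (zero_add j)) :
    Function.Surjective (extColimMap (𝔞 := 𝔞) β h) := by
  intro y
  obtain ⟨t, y, rfl⟩ := exists_toExtColim_eq y
  obtain ⟨s, hs, x, hx⟩ := hβ t y
  exact ⟨toExtColim s x, by rw [extColimMap_toExtColim, hx, toExtColim_precomp]⟩

lemma smul_eq_zero_of_mem_pow {t : ℕ} (x : Abelian.Ext ((quotPow 𝔞).obj (op t)) M i) {r : R}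
    (hr : r ∈ 𝔞 ^ t) : r • x = 0 := by
  have h : r • 𝟙 ((quotPow 𝔞).obj (op t)) = 0 := by
    ext y
    obtain ⟨y, rfl⟩ := Ideal.Quotient.mk_surjective y
    change Ideal.Quotient.mk (𝔞 ^ t) (r * y) = 0
    exact Ideal.Quotient.eq_zero_iff_mem.2 (Ideal.mul_mem_right _ _ hr)
  rw [← Ext.mk₀_id_comp x, ← Ext.smul_comp, ← Ext.mk₀_smul, h, Ext.mk₀_zero, Ext.zero_comp]

lemma exists_forall_smul_eq_zero (x : extColim 𝔞 i M) : ∃ t : ℕ, ∀ r ∈ 𝔞 ^ t, r • x = 0 := by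
  obtain ⟨t, x, rfl⟩ := exists_toExtColim_eq x
  exact ⟨t, fun r hr ↦ by rw [← map_smul, smul_eq_zero_of_mem_pow x hr, map_zero]⟩

variable (𝔞 i M)

/-- Local cohomology as the colimit of the modules `Ext^i(R ⧸ 𝔞 ^ t, M)` of the derived category. -/
noncomputable def isoExtColim : (localCohomology 𝔞 i).obj M ≅ extColim 𝔞 i M :=
  -- Colimits of functors are computed pointwise, which leaves a termwise comparison of `Ext`
  -- modules.
  colimitObjIsoColimitCompEvaluation (diagram (idealPowersDiagram 𝔞) i) M ≪≫
    HasColimit.isoOfNatIso (NatIso.ofComponents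
      (fun t ↦ ((projectiveResolution ((quotPow 𝔞).obj t.unop)).leftDerivedExtEquiv
        M R i).toModuleIso)
      (fun {t s} f ↦ by
        ext x
        exact ProjectiveResolution.leftDerivedExtEquiv_naturality M R
          (⟨ProjectiveResolution.lift ((quotPow 𝔞).map f.unop) _ _, by
            exact ProjectiveResolution.lift_commutes_zero _ _ _⟩ :
            ProjectiveResolution.Hom _ _ ((quotPow 𝔞).map f.unop)) i x))

end localCohomology

/-- `Ext^i(R ⧸ 𝔞, M)` in terms of the derived category. -/
noncomputable def extQuotientEquiv (𝔞 : Ideal R) (i : ℕ) (M : ModuleCat.{u} R) :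
    extQuotient 𝔞 i M ≃ₗ[R] Abelian.Ext (ModuleCat.of R (R ⧸ 𝔞)) M i :=
  (projectiveResolution (ModuleCat.of R (R ⧸ 𝔞))).leftDerivedExtEquiv M R i

end LocalCohomologyExt

/-! ### `𝔞`-power torsion and injective modules over noetherian rings. -/

section PowTorsion

variable {R : Type u} [CommRing R] (𝔞 : Ideal R)

/-- The submodule of elements annihilated by some power of `𝔞`. -/
def powTorsion (M : Type u) [AddCommGroup M] [Module R M] : Submodule R M where
  carrier := {x | ∃ k : ℕ, ∀ r ∈ 𝔞 ^ k, r • x = 0}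
  zero_mem' := ⟨0, fun r _ ↦ smul_zero r⟩
  add_mem' := by
    rintro x y ⟨k, hk⟩ ⟨l, hl⟩
    refine ⟨k + l, fun r hr ↦ ?_⟩
    rw [smul_add, hk r (Ideal.pow_le_pow_right (Nat.le_add_right k l) hr),
      hl r (Ideal.pow_le_pow_right (Nat.le_add_left l k) hr), add_zero]
  smul_mem' := by
    rintro s x ⟨k, hk⟩
    exact ⟨k, fun r hr ↦ by rw [smul_comm, hk r hr, smul_zero]⟩

variable {𝔞} {M N : Type u} [AddCommGroup M] [Module R M] [AddCommGroup N] [Module R N]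

lemma map_mem_powTorsion (f : M →ₗ[R] N) {x : M} (hx : x ∈ powTorsion 𝔞 M) :
    f x ∈ powTorsion 𝔞 N := by
  obtain ⟨k, hk⟩ := hx
  exact ⟨k, fun r hr ↦ by rw [← map_smul, hk r hr, map_zero]⟩

lemma exists_pow_smul_eq_zero_of_fg {L : Submodule R M} (hL : L.FG) (h : L ≤ powTorsion 𝔞 M) :
    ∃ k : ℕ, ∀ x ∈ L, ∀ r ∈ 𝔞 ^ k, r • x = 0 := by
  obtain ⟨s, rfl⟩ := hL
  choose! k hk using fun x (hx : x ∈ s) ↦ h (Submodule.subset_span hx)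
  refine ⟨s.sup k, fun x hx r hr ↦ ?_⟩
  induction hx using Submodule.span_induction with
  | mem x hx => exact hk x hx r (Ideal.pow_le_pow_right (Finset.le_sup hx) hr)
  | zero => exact smul_zero r
  | add x y _ _ hx hy => rw [smul_add, hx, hy, add_zero]
  | smul c x _ hx => rw [smul_comm, hx, smul_zero]

variable (M) in
lemma exists_injective_linearMap_to_injective :
    ∃ (E : ModuleCat.{u} R) (f : M →ₗ[R] E), Module.Injective R E ∧ Function.Injective f :=
  ⟨Injective.under (ModuleCat.of R M), (Injective.ι (ModuleCat.of R M)).hom,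
    Module.injective_module_of_injective_object R _ (inj := Injective.injective_under _),
    (ModuleCat.mono_iff_injective _).1 inferInstance⟩

variable [IsNoetherianRing R]

lemma mem_powTorsion_of_pow_smul_mem {x : M} {k : ℕ} (h : ∀ r ∈ 𝔞 ^ k, r • x ∈ powTorsion 𝔞 M) :
    x ∈ powTorsion 𝔞 M := by
  have hfg : (Submodule.map (LinearMap.toSpanSingleton R M x) (𝔞 ^ k)).FG :=
    (IsNoetherian.noetherian (𝔞 ^ k)).map _
  obtain ⟨l, hl⟩ := exists_pow_smul_eq_zero_of_fg (𝔞 := 𝔞) hfg (by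
    rintro _ ⟨r, hr, rfl⟩
    exact h r hr)
  refine ⟨l + k, fun r hr ↦ ?_⟩
  rw [pow_add] at hr
  induction hr using Submodule.mul_induction_on' with
  | mem_mul_mem a ha b hb =>
    rw [mul_smul]
    exact hl _ ⟨b, hb, rfl⟩ a ha
  | add a _ b _ ha hb => rw [add_smul, ha, hb, add_zero]

/-- Baer's criterion with Artin–Rees: `g : I → Γ(M)` has image killed by some `𝔞^k` and kills `I ∩
𝔞^(k+c) ⊆ 𝔞^k I`, so it factors through a submodule of `R/𝔞^(k+c)`. Any extension of that map from
`R/𝔞^(k+c)` to `M` has torsion values. -/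
instance powTorsion_injective [Module.Injective R M] : Module.Injective R (powTorsion 𝔞 M) := by
  refine Module.Baer.injective fun I g ↦ ?_
  obtain ⟨k, hk⟩ := exists_pow_smul_eq_zero_of_fg (𝔞 := 𝔞) (M := powTorsion 𝔞 M)
    (L := LinearMap.range g) (LinearMap.range_eq_map g ▸ (Module.Finite.fg_top.map g)) (by
      rintro x -
      obtain ⟨k, hk⟩ := x.2
      exact ⟨k, fun r hr ↦ Subtype.ext (hk r hr)⟩)
  obtain ⟨c, hc⟩ := Ideal.exists_pow_inf_eq_pow_smul 𝔞 I
  have hker : ∀ x (hx : x ∈ I), x ∈ 𝔞 ^ (k + c) → g ⟨x, hx⟩ = 0 := by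
    intro x hx hxm
    have h1 : x ∈ 𝔞 ^ k • I := by
      have h2 : x ∈ 𝔞 ^ (k + c) • (⊤ : Submodule R R) ⊓ I := ⟨by simpa using hxm, hx⟩
      rw [hc _ (Nat.le_add_left c k), Nat.add_sub_cancel] at h2
      exact Submodule.smul_mono le_rfl inf_le_right h2
    have h3 : ∃ h : x ∈ I, g ⟨x, h⟩ = 0 := by
      refine Submodule.smul_induction_on h1 (fun r hr y hy ↦ ?_) ?_
      · exact ⟨I.smul_mem r hy, (g.map_smul r ⟨y, hy⟩).trans (hk _ ⟨_, rfl⟩ r hr)⟩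
      · rintro y z ⟨hy, hy'⟩ ⟨hz, hz'⟩
        exact ⟨I.add_mem hy hz, (g.map_add ⟨y, hy⟩ ⟨z, hz⟩).trans (by rw [hy', hz', add_zero])⟩
    exact h3.2
  let ι : I →ₗ[R] R ⧸ 𝔞 ^ (k + c) := (Submodule.mkQ (𝔞 ^ (k + c))).comp I.subtype
  have hι : LinearMap.ker ι ≤ LinearMap.ker ((powTorsion 𝔞 M).subtype.comp g) := by
    intro x hx
    have hx' : (x : R) ∈ 𝔞 ^ (k + c) := by
      exact (Submodule.Quotient.mk_eq_zero _).1 hx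
    rw [LinearMap.mem_ker, LinearMap.comp_apply, hker x x.2 hx', map_zero]
  obtain ⟨h, hh⟩ := Module.Injective.out ((LinearMap.ker ι).liftQ ι le_rfl)
    (LinearMap.ker_eq_bot.1 (Submodule.ker_liftQ_eq_bot _ _ _ le_rfl))
    ((LinearMap.ker ι).liftQ ((powTorsion 𝔞 M).subtype.comp g) hι)
  refine ⟨(h.comp (Submodule.mkQ (𝔞 ^ (k + c)))).codRestrict (powTorsion 𝔞 M) fun x ↦
    ⟨k + c, fun r hr ↦ ?_⟩, fun x hx ↦ Subtype.ext (hh (Submodule.Quotient.mk ⟨x, hx⟩))⟩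
  have h0 : Submodule.mkQ (𝔞 ^ (k + c)) (r • x) = 0 :=
    (Submodule.Quotient.mk_eq_zero _).2 (Ideal.mul_mem_right x _ hr)
  rw [← map_smul, LinearMap.comp_apply, h0, map_zero]

/-- Being injective, `Γ(M)` is a direct summand, so the quotient is a retract of `M`. -/
instance quotient_powTorsion_injective [Module.Injective R M] :
    Module.Injective R (M ⧸ powTorsion 𝔞 M) := by
  obtain ⟨ρ, hρ⟩ := Module.Injective.out (powTorsion 𝔞 M).subtype
    (powTorsion 𝔞 M).injective_subtype LinearMap.id
  let σ : (M ⧸ powTorsion 𝔞 M) →ₗ[R] M :=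
    (powTorsion 𝔞 M).liftQ (LinearMap.id - (powTorsion 𝔞 M).subtype.comp ρ) (fun x hx ↦ by
      have := hρ ⟨x, hx⟩
      simp only [Submodule.subtype_apply, LinearMap.id_apply] at this
      simp [this])
  have hσ : ∀ x, Submodule.mkQ (powTorsion 𝔞 M) (σ x) = x := by
    intro x
    obtain ⟨x, rfl⟩ := Submodule.mkQ_surjective _ x
    simp [σ]
  refine ⟨fun X Y _ _ _ _ f hf g ↦ ?_⟩
  obtain ⟨h, hh⟩ := Module.Injective.out f hf (σ.comp g)
  exact ⟨(Submodule.mkQ _).comp h, fun x ↦ by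
    rw [LinearMap.comp_apply, hh, LinearMap.comp_apply, hσ]⟩

lemma powTorsion_quotient_powTorsion : powTorsion 𝔞 (M ⧸ powTorsion 𝔞 M) = ⊥ := by
  rw [eq_bot_iff]
  rintro x ⟨k, hk⟩
  obtain ⟨x, rfl⟩ := Submodule.mkQ_surjective _ x
  rw [Submodule.mem_bot, Submodule.mkQ_apply, Submodule.Quotient.mk_eq_zero]
  refine mem_powTorsion_of_pow_smul_mem (k := k) fun r hr ↦ ?_
  rw [← Submodule.Quotient.mk_eq_zero]
  exact hk r hr

variable (M 𝔞)

/-- A torsion-free module embeds into a torsion-free injective module. -/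
lemma exists_embedding_of_powTorsion_eq_bot (hM : powTorsion 𝔞 M = ⊥) :
    ∃ (E : ModuleCat.{u} R) (f : M →ₗ[R] E), Module.Injective R E ∧ Function.Injective f ∧
      powTorsion 𝔞 E = ⊥ := by
  obtain ⟨E, f, hE, hf⟩ := exists_injective_linearMap_to_injective (R := R) M
  refine ⟨ModuleCat.of R (E ⧸ powTorsion 𝔞 E), (Submodule.mkQ _).comp f,
    quotient_powTorsion_injective, ?_, powTorsion_quotient_powTorsion⟩
  rw [injective_iff_map_eq_zero]
  intro x hx
  rw [LinearMap.comp_apply, Submodule.mkQ_apply, Submodule.Quotient.mk_eq_zero] at hx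
  rw [← Submodule.mem_bot R, ← hM]
  obtain ⟨k, hk⟩ := hx
  exact ⟨k, fun r hr ↦ hf (by rw [map_smul, hk r hr, map_zero])⟩

/-- A torsion module embeds into a torsion injective module. -/
lemma exists_embedding_of_powTorsion_eq_top (hM : powTorsion 𝔞 M = ⊤) :
    ∃ (E : ModuleCat.{u} R) (f : M →ₗ[R] E), Module.Injective R E ∧ Function.Injective f ∧
      powTorsion 𝔞 E = ⊤ := by
  obtain ⟨E, f, hE, hf⟩ := exists_injective_linearMap_to_injective (R := R) M
  refine ⟨ModuleCat.of R (powTorsion 𝔞 E),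
    f.codRestrict _ fun x ↦ map_mem_powTorsion f (hM ▸ Submodule.mem_top),
    powTorsion_injective, fun x y h ↦ hf congr(($h).1), ?_⟩
  rw [eq_top_iff]
  rintro ⟨x, k, hk⟩ -
  exact ⟨k, fun r hr ↦ Subtype.ext (hk r hr)⟩

end PowTorsion

/-! ### Dimension shifting for `Ext` and its colimit. -/

section ExtColimShift

open Opposite Abelian

variable {R : Type u} [CommRing R] {𝔞 : Ideal R}

/-- The short complex `0 → M → N → N / M → 0` of an embedding. -/
noncomputable abbrev LinearMap.shortComplexCokernel {M N : Type u} [AddCommGroup M] [Module R M]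
    [AddCommGroup N] [Module R N] (f : M →ₗ[R] N) : ShortComplex (ModuleCat.{u} R) :=
  ModuleCat.shortComplexOfCompEqZero f (LinearMap.range f).mkQ (by
    ext x
    simp)

lemma LinearMap.shortExact_shortComplexCokernel {M N : Type u} [AddCommGroup M] [Module R M]
    [AddCommGroup N] [Module R N] {f : M →ₗ[R] N} (hf : Function.Injective f) :
    f.shortComplexCokernel.ShortExact :=
  ModuleCat.shortComplex_shortExact _ (LinearMap.exact_map_mkQ_range f) hf
    (Submodule.mkQ_surjective _)

lemma injective_of_module_injective (E : ModuleCat.{u} R) [Module.Injective R E] : Injective E :=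
  Module.injective_object_of_injective_module R E

lemma powTorsion_quotient_eq_top (J : Ideal R) {t : ℕ} (hJ : 𝔞 ^ t ≤ J) :
    powTorsion 𝔞 (R ⧸ J) = ⊤ := by
  rw [eq_top_iff]
  rintro x -
  obtain ⟨x, rfl⟩ := Submodule.mkQ_surjective _ x
  refine ⟨t, fun r hr ↦ ?_⟩
  rw [← map_smul]
  exact (Submodule.Quotient.mk_eq_zero _).2 (Ideal.mul_mem_right x _ (hJ hr))

/-- There are no extensions of a torsion module by a torsion-free injective module. -/
lemma ext_eq_zero_of_injective_of_powTorsion_eq_bot {X E : ModuleCat.{u} R}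
    [Module.Injective R E] (hX : powTorsion 𝔞 X = ⊤) (hE : powTorsion 𝔞 E = ⊥) {i : ℕ}
    (x : Abelian.Ext X E i) : x = 0 := by
  have := injective_of_module_injective E
  cases i with
  | zero =>
    obtain ⟨f, rfl⟩ := Ext.homEquiv₀.symm.surjective x
    have hf : f = 0 := by
      ext y
      have := map_mem_powTorsion (𝔞 := 𝔞) f.hom (x := y) (hX ▸ Submodule.mem_top)
      rwa [hE] at this
    rw [hf]
    exact Ext.mk₀_zero X E
  | succ i => exact Ext.eq_zero_of_injective x

lemma extClass_postcomp_bijective {S : ShortComplex (ModuleCat.{u} R)} (hS : S.ShortExact)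
    [Module.Injective R S.X₂] (h₂ : powTorsion 𝔞 S.X₂ = ⊥) {X : ModuleCat.{u} R}
    (hX : powTorsion 𝔞 X = ⊤) (i : ℕ) :
    Function.Bijective (hS.extClass.postcompOfLinear R X (rfl : i + 1 = i + 1)) := by
  constructor
  · rw [injective_iff_map_eq_zero]
    intro x hx
    obtain ⟨y, rfl⟩ := Ext.covariant_sequence_exact₃ X hS x rfl hx
    rw [ext_eq_zero_of_injective_of_powTorsion_eq_bot hX h₂ y, Ext.zero_comp]
  · intro y
    exact Ext.covariant_sequence_exact₁ X hS y
      (ext_eq_zero_of_injective_of_powTorsion_eq_bot hX h₂ _) rfl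

namespace localCohomology

lemma powTorsion_quotPow (t : ℕ) : powTorsion 𝔞 ((quotPow 𝔞).obj (op t)) = ⊤ :=
  powTorsion_quotient_eq_top (𝔞 ^ t) le_rfl

lemma extColimMap_extClass_bijective {S : ShortComplex (ModuleCat.{u} R)} (hS : S.ShortExact)
    [Module.Injective R S.X₂] (h₂ : powTorsion 𝔞 S.X₂ = ⊥) (i : ℕ) :
    Function.Bijective (extColimMap (𝔞 := 𝔞) hS.extClass (rfl : i + 1 = i + 1)) := by
  refine ⟨extColimMap_injective _ _ fun t x hx ↦ ⟨t, le_rfl, ?_⟩,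
    extColimMap_surjective _ _ fun t y ↦ ⟨t, le_rfl, ?_⟩⟩
  · rw [(injective_iff_map_eq_zero _).1
      (extClass_postcomp_bijective hS h₂ (powTorsion_quotPow t) i).1 x hx, Ext.comp_zero]
  · exact (extClass_postcomp_bijective hS h₂ (powTorsion_quotPow t) i).2 _

/-- Homomorphisms from `R ⧸ 𝔞 ^ t` lift along surjections from torsion modules, up to increasing
the exponent. -/
lemma exists_lift_quotPow {B C : ModuleCat.{u} R} (g : B ⟶ C) [Epi g] (hB : powTorsion 𝔞 B = ⊤)
    {t : ℕ} (φ : (quotPow 𝔞).obj (op t) ⟶ C) :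
    ∃ (s : ℕ) (h : t ≤ s) (ψ : (quotPow 𝔞).obj (op s) ⟶ B), quotPowMap 𝔞 h ≫ φ = ψ ≫ g := by
  obtain ⟨b, hb⟩ := (ModuleCat.epi_iff_surjective g).1 inferInstance
    (φ (Submodule.Quotient.mk 1 : R ⧸ 𝔞 ^ t))
  obtain ⟨k, hk⟩ : b ∈ powTorsion 𝔞 B := hB ▸ Submodule.mem_top
  let ψ : (R ⧸ 𝔞 ^ (t + k)) →ₗ[R] B :=
    (𝔞 ^ (t + k)).liftQ (LinearMap.toSpanSingleton R B b) fun r hr ↦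
      hk r (Ideal.pow_le_pow_right (Nat.le_add_left k t) hr)
  -- `𝔞^k` kills the chosen preimage `b`; adding `t` makes the projection to `R/𝔞^t` available.
  refine ⟨t + k, Nat.le_add_right t k, ModuleCat.ofHom ψ, ?_⟩
  ext x
  obtain ⟨r, rfl⟩ := Submodule.mkQ_surjective _ x
  have h1 : (Submodule.Quotient.mk r : R ⧸ 𝔞 ^ t) = r • Submodule.Quotient.mk 1 := by
    rw [← Submodule.Quotient.mk_smul, smul_eq_mul, mul_one]
  change φ (Submodule.Quotient.mk r : R ⧸ 𝔞 ^ t) = g (r • b)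
  rw [map_smul, hb, h1]
  exact map_smul φ.hom r _

variable [IsNoetherianRing R]

/-- Every extension class of `R ⧸ 𝔞 ^ t` by a torsion module vanishes after increasing `t`. -/
lemma exists_precomp_eq_zero_of_powTorsion_eq_top (i : ℕ) {T : ModuleCat.{u} R}
    (hT : powTorsion 𝔞 T = ⊤) {t : ℕ} (x : Abelian.Ext ((quotPow 𝔞).obj (op t)) T (i + 1)) :
    ∃ (s : ℕ) (h : t ≤ s),
      (Ext.mk₀ (quotPowMap 𝔞 h)).comp x (zero_add (i + 1)) = 0 := by
  induction i generalizing T with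
  | zero =>
    obtain ⟨E, f, hE, hf, hEt⟩ := exists_embedding_of_powTorsion_eq_top 𝔞 T hT
    have hS := LinearMap.shortExact_shortComplexCokernel hf
    have := injective_of_module_injective E
    have := hS.epi_g
    obtain ⟨y, rfl⟩ := Ext.covariant_sequence_exact₁ _ hS x (Ext.eq_zero_of_injective (I := E) _)
      (zero_add 1)
    obtain ⟨φ, rfl⟩ := Ext.homEquiv₀.symm.surjective y
    -- The class is the connecting image of `φ : R/𝔞^t → E/T`; once `φ` lifts to `E`, that image is
    -- zero.
    obtain ⟨s, h, ψ, hψ⟩ := exists_lift_quotPow f.shortComplexCokernel.g hEt φ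
    refine ⟨s, h, ?_⟩
    change (Ext.mk₀ _).comp ((Ext.mk₀ φ).comp hS.extClass _) _ = 0
    rw [Ext.mk₀_comp_mk₀_assoc, hψ, ← Ext.mk₀_comp_mk₀_assoc, hS.comp_extClass, Ext.comp_zero]
  | succ i ih =>
    obtain ⟨E, f, hE, hf, hEt⟩ := exists_embedding_of_powTorsion_eq_top 𝔞 T hT
    have hS := LinearMap.shortExact_shortComplexCokernel hf
    have := injective_of_module_injective E
    obtain ⟨y, rfl⟩ := Ext.covariant_sequence_exact₁ _ hS x (Ext.eq_zero_of_injective (I := E) _)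
      rfl
    have hC : powTorsion 𝔞 f.shortComplexCokernel.X₃ = ⊤ := by
      rw [eq_top_iff]
      rintro c -
      obtain ⟨e, rfl⟩ := Submodule.mkQ_surjective _ c
      exact map_mem_powTorsion _ (hEt ▸ Submodule.mem_top)
    obtain ⟨s, h, hs⟩ := ih hC y
    exact ⟨s, h, by rw [← Ext.comp_assoc _ _ _ (zero_add _) rfl (by lia), hs, Ext.zero_comp]⟩

/-- Kernel classes come from `Ext^(i+1)` into the torsion module `S.X₁` and lifting obstructions lie
in `Ext^(i+2)`. Both die after increasing `t`, their degrees being positive. -/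
lemma extColimMap_mk₀_g_bijective {S : ShortComplex (ModuleCat.{u} R)} (hS : S.ShortExact)
    (h₁ : powTorsion 𝔞 S.X₁ = ⊤) (i : ℕ) :
    Function.Bijective (extColimMap (𝔞 := 𝔞) (Ext.mk₀ S.g) (add_zero (i + 1))) := by
  refine ⟨extColimMap_injective _ _ fun t x hx ↦ ?_, extColimMap_surjective _ _ fun t y ↦ ?_⟩
  · obtain ⟨y, rfl⟩ := Ext.covariant_sequence_exact₂ _ hS x hx
    obtain ⟨s, h, hs⟩ := exists_precomp_eq_zero_of_powTorsion_eq_top i h₁ y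
    exact ⟨s, h, by rw [← Ext.comp_assoc _ _ _ (zero_add _) (add_zero _) (by lia), hs,
      Ext.zero_comp]⟩
  · obtain ⟨s, h, hs⟩ := exists_precomp_eq_zero_of_powTorsion_eq_top (i + 1) h₁
      (y.comp hS.extClass rfl)
    refine ⟨s, h, Ext.covariant_sequence_exact₃ _ hS _ rfl ?_⟩
    rw [Ext.comp_assoc _ _ _ (zero_add _) rfl (by lia), hs]

end localCohomology

end ExtColimShift

/-! ### Serre classes, `Ext`, and the equivalence with `Hom(R/𝔞, H^n)`. -/

section Serre

open Opposite Limits Abelian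

variable {R : Type u} [CommRing R] {𝔞 : Ideal R}

namespace localCohomology

variable (𝔞) in
/-- The comparison of `colim_t Hom(R ⧸ 𝔞 ^ t, M)` with the torsion submodule of `M`. -/
noncomputable def extColimZeroTo (M : ModuleCat.{u} R) : extColim 𝔞 0 M →ₗ[R] M :=
  (colimit.desc (extPow 𝔞 0 M)
    { pt := M
      ι :=
        { app := fun t ↦ ModuleCat.ofHom
            ((LinearMap.applyₗ (Submodule.Quotient.mk 1 : R ⧸ 𝔞 ^ t.unop.unop)).comp
              ((Ext.linearEquiv₀ (R := R)).trans
                (ModuleCat.homLinearEquiv (S := R))).toLinearMap)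
          naturality := by
            intro t s f
            ext x
            obtain ⟨φ, rfl⟩ := Ext.homEquiv₀.symm.surjective x
            have h : (extPow 𝔞 0 M).map f (Ext.mk₀ φ) =
                Ext.mk₀ ((quotPow 𝔞).map f.unop ≫ φ) := Ext.mk₀_comp_mk₀ _ _
            change (Ext.linearEquiv₀ (R := R) ((extPow 𝔞 0 M).map f (Ext.mk₀ φ))).hom _ =
              (Ext.linearEquiv₀ (R := R) (Ext.mk₀ φ)).hom _
            rw [h, ← Ext.linearEquiv₀_symm_apply (R := R), ← Ext.linearEquiv₀_symm_apply (R := R),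
              LinearEquiv.apply_symm_apply, LinearEquiv.apply_symm_apply]
            rfl } }).hom

lemma extColimZeroTo_toExtColim {M : ModuleCat.{u} R} {t : ℕ}
    (φ : (quotPow 𝔞).obj (op t) ⟶ M) :
    extColimZeroTo 𝔞 M (toExtColim t (Ext.mk₀ φ)) =
      φ (Submodule.Quotient.mk 1 : R ⧸ 𝔞 ^ t) := by
  refine (congr($(colimit.ι_desc (F := extPow 𝔞 0 M) _ (op (op t))) (Ext.mk₀ φ)) :).trans ?_
  change (Ext.linearEquiv₀ (R := R) (Ext.mk₀ φ)).hom _ = _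
  rw [← Ext.linearEquiv₀_symm_apply (R := R), LinearEquiv.apply_symm_apply]

lemma extColimZeroTo_injective (M : ModuleCat.{u} R) :
    Function.Injective (extColimZeroTo 𝔞 M) := by
  rw [injective_iff_map_eq_zero]
  intro x hx
  obtain ⟨t, x, rfl⟩ := exists_toExtColim_eq x
  obtain ⟨φ, rfl⟩ := Ext.homEquiv₀.symm.surjective x
  have h := (extColimZeroTo_toExtColim φ).symm.trans hx
  have hφ : φ = 0 := by
    ext y
    obtain ⟨r, rfl⟩ := Submodule.mkQ_surjective _ y
    have h1 : (Submodule.mkQ (𝔞 ^ t) r : R ⧸ 𝔞 ^ t) = r • Submodule.Quotient.mk 1 := by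
      rw [← Submodule.Quotient.mk_smul, smul_eq_mul, mul_one]
      rfl
    exact (congrArg φ.hom h1).trans
      ((map_smul φ.hom r _).trans ((congrArg (r • ·) h).trans (smul_zero r)))
  have h0 : Ext.homEquiv₀.symm φ = (0 : Abelian.Ext ((quotPow 𝔞).obj (op t)) M 0) := by
    rw [hφ]
    exact Ext.mk₀_zero _ M
  rw [h0, map_zero]

lemma range_extColimZeroTo (M : ModuleCat.{u} R) :
    LinearMap.range (extColimZeroTo 𝔞 M) = powTorsion 𝔞 M := by
  apply le_antisymm
  · rintro _ ⟨x, rfl⟩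
    exact map_mem_powTorsion _ (exists_forall_smul_eq_zero x)
  · rintro m ⟨t, ht⟩
    let φ : (quotPow 𝔞).obj (op t) ⟶ M :=
      ModuleCat.ofHom ((𝔞 ^ t).liftQ (LinearMap.toSpanSingleton R M m) ht)
    exact ⟨toExtColim t (Ext.mk₀ φ), (extColimZeroTo_toExtColim φ).trans (one_smul R m)⟩

variable (𝔞) in
/-- Local cohomology in degree zero is the torsion submodule. -/
noncomputable def extColimZeroEquiv (M : ModuleCat.{u} R) : extColim 𝔞 0 M ≃ₗ[R] powTorsion 𝔞 M :=
  (LinearEquiv.ofInjective _ (extColimZeroTo_injective M)).trans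
    (LinearEquiv.ofEq _ _ (range_extColimZeroTo M))

end localCohomology

/-- The module of extensions. -/
noncomputable abbrev extModule (X M : ModuleCat.{u} R) (i : ℕ) : ModuleCat.{u} R :=
  ModuleCat.of R (Abelian.Ext X M i)

/-- Extension modules of isomorphic modules are isomorphic. -/
noncomputable def extModuleCongr (X : ModuleCat.{u} R) {M N : ModuleCat.{u} R} (e : M ≅ N)
    (i : ℕ) : extModule X M i ≃ₗ[R] extModule X N i :=
  LinearEquiv.ofLinearMap ((Ext.mk₀ e.hom).postcompOfLinear R X (add_zero i))
    ((Ext.mk₀ e.inv).postcompOfLinear R X (add_zero i)) (by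
      ext x
      change (x.comp _ (add_zero i)).comp _ (add_zero i) = x
      rw [Ext.comp_assoc_of_third_deg_zero, Ext.mk₀_comp_mk₀, e.inv_hom_id, Ext.comp_mk₀_id]) (by
      ext x
      change (x.comp _ (add_zero i)).comp _ (add_zero i) = x
      rw [Ext.comp_assoc_of_third_deg_zero, Ext.mk₀_comp_mk₀, e.hom_inv_id, Ext.comp_mk₀_id])

lemma extModule_postcomp_bijective_of_torsion {X N M : ModuleCat.{u} R}
    (hX : powTorsion 𝔞 X = ⊤) (j : N →ₗ[R] M) (hj : Function.Injective j)
    (hr : powTorsion 𝔞 M ≤ LinearMap.range j) :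
    Function.Bijective ((Ext.mk₀ (ModuleCat.ofHom j)).postcompOfLinear R X (add_zero 0)) := by
  have : Mono (ModuleCat.ofHom j) := (ModuleCat.mono_iff_injective _).2 hj
  refine ⟨Ext.postcomp_mk₀_injective_of_mono X (ModuleCat.ofHom j), fun x ↦ ?_⟩
  obtain ⟨φ, rfl⟩ := Ext.homEquiv₀.symm.surjective x
  let ψ : X →ₗ[R] N := (LinearEquiv.ofInjective j hj).symm.toLinearMap.comp
    (φ.hom.codRestrict (LinearMap.range j) fun y ↦
      hr (map_mem_powTorsion φ.hom (hX ▸ Submodule.mem_top)))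
  refine ⟨Ext.mk₀ (ModuleCat.ofHom ψ), ?_⟩
  refine (Ext.mk₀_comp_mk₀ (ModuleCat.ofHom ψ) (ModuleCat.ofHom j)).trans (congrArg Ext.mk₀ ?_)
  ext y
  exact congrArg Subtype.val ((LinearEquiv.ofInjective j hj).apply_symm_apply _)

lemma exact_postcomp_f_g (X : ModuleCat.{u} R) {T : ShortComplex (ModuleCat.{u} R)}
    (hT : T.ShortExact) (i : ℕ) :
    Function.Exact ((Ext.mk₀ T.f).postcompOfLinear R X (add_zero i))
      ((Ext.mk₀ T.g).postcompOfLinear R X (add_zero i)) := by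
  refine fun x ↦ ⟨fun hx ↦ Ext.covariant_sequence_exact₂ X hT x hx, ?_⟩
  rintro ⟨y, rfl⟩
  change (y.comp _ (add_zero i)).comp _ (add_zero i) = 0
  rw [Ext.comp_assoc_of_third_deg_zero, Ext.mk₀_comp_mk₀, T.zero, Ext.mk₀_zero, Ext.comp_zero]

lemma exact_postcomp_g_extClass (X : ModuleCat.{u} R) {T : ShortComplex (ModuleCat.{u} R)}
    (hT : T.ShortExact) (i : ℕ) :
    Function.Exact ((Ext.mk₀ T.g).postcompOfLinear R X (add_zero i))
      (hT.extClass.postcompOfLinear R X (rfl : i + 1 = i + 1)) := by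
  refine fun x ↦ ⟨fun hx ↦ Ext.covariant_sequence_exact₃ X hT x rfl hx, ?_⟩
  rintro ⟨y, rfl⟩
  change (y.comp _ (add_zero i)).comp _ (rfl : i + 1 = i + 1) = 0
  rw [Ext.comp_assoc_of_second_deg_zero, hT.comp_extClass, Ext.comp_zero]

namespace CategoryTheory.ObjectProperty

variable (S : ObjectProperty (ModuleCat.{u} R)) [S.IsSerreClass]

lemma moduleCat_prop_iff {A B : Type u} [AddCommGroup A] [Module R A] [AddCommGroup B]
    [Module R B] (e : A ≃ₗ[R] B) : S (ModuleCat.of R A) ↔ S (ModuleCat.of R B) :=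
  S.prop_iff_of_iso e.toModuleIso

lemma moduleCat_prop_of_exact {A B C : Type u} [AddCommGroup A] [Module R A] [AddCommGroup B]
    [Module R B] [AddCommGroup C] [Module R C] (f : A →ₗ[R] B) (g : B →ₗ[R] C)
    (h : Function.Exact f g) (hA : S (ModuleCat.of R A)) (hC : S (ModuleCat.of R C)) :
    S (ModuleCat.of R B) :=
  S.prop_X₂_of_exact (S := ModuleCat.shortComplexOfCompEqZero f g h.linearMap_comp_eq_zero)
    (ModuleCat.shortComplex_exact _ h) hA hC

lemma moduleCat_prop_of_injective {A B : Type u} [AddCommGroup A] [Module R A] [AddCommGroup B]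
    [Module R B] (f : A →ₗ[R] B) (hf : Function.Injective f) (hB : S (ModuleCat.of R B)) :
    S (ModuleCat.of R A) :=
  have : Mono (ModuleCat.ofHom f) := (ModuleCat.mono_iff_injective _).2 hf
  S.prop_of_mono (ModuleCat.ofHom f) hB

lemma moduleCat_prop_of_surjective {A B : Type u} [AddCommGroup A] [Module R A] [AddCommGroup B]
    [Module R B] (f : A →ₗ[R] B) (hf : Function.Surjective f) (hA : S (ModuleCat.of R A)) :
    S (ModuleCat.of R B) :=
  have : Epi (ModuleCat.ofHom f) := (ModuleCat.epi_iff_surjective _).2 hf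
  S.prop_of_epi (ModuleCat.ofHom f) hA

lemma moduleCat_prop_pi_fin {N : Type u} [AddCommGroup N] [Module R N]
    (hN : S (ModuleCat.of R N)) (m : ℕ) : S (ModuleCat.of R (Fin m → N)) := by
  induction m with
  | zero =>
    refine S.moduleCat_prop_of_surjective (0 : N →ₗ[R] (Fin 0 → N)) (fun x ↦ ⟨0, ?_⟩) hN
    exact Subsingleton.elim _ _
  | succ m ih =>
    refine S.moduleCat_prop_of_exact (LinearMap.single R (fun _ : Fin (m + 1) ↦ N) 0)
      (LinearMap.funLeft R N Fin.succ) (fun x ↦ ⟨fun hx ↦ ⟨x 0, ?_⟩, ?_⟩) hN ih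
    · ext k
      refine Fin.cases ?_ (fun k ↦ ?_) k
      · simp
      · have := congrFun hx k
        simp only [LinearMap.funLeft_apply, Pi.zero_apply] at this
        simp [this]
    · rintro ⟨y, rfl⟩
      ext k
      simp [LinearMap.funLeft_apply]

/-- Serre classes are closed under `Ext^i(X, -)` for `X` finite over a noetherian ring. -/
lemma prop_extModule [IsNoetherianRing R] (X : ModuleCat.{u} R) [Module.Finite R X]
    {N : ModuleCat.{u} R} (hN : S N) (i : ℕ) : S (extModule X N i) := by
  induction i generalizing X with
  | zero =>
    -- A surjection `R^m → X` embeds `Hom(X, N)` in `N^m`.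
    obtain ⟨m, f, hf⟩ := Module.Finite.exists_fin' R X
    refine S.moduleCat_prop_of_injective
      ((LinearMap.pi fun k ↦ LinearMap.applyₗ (f (Pi.single k 1))).comp
        ((Ext.linearEquiv₀ (R := R)).trans (ModuleCat.homLinearEquiv (S := R))).toLinearMap) ?_
      (S.moduleCat_prop_pi_fin hN m)
    refine Function.Injective.comp (g := LinearMap.pi fun k ↦
      LinearMap.applyₗ (f (Pi.single k 1))) ?_ (LinearEquiv.injective _)
    rw [injective_iff_map_eq_zero]
    intro φ hφ
    have : φ.comp f = 0 := by
      ext k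
      simpa using congrFun hφ k
    ext x
    obtain ⟨y, rfl⟩ := hf x
    exact congr($this y)
  | succ i ih =>
    obtain ⟨N', _, _, _, _, f, surjf⟩ := Module.exists_finite_presentation R X
    let exac := LinearMap.shortExact_shortComplexKer surjf
    -- The middle term is projective, so `Ext^i` of the kernel surjects onto `Ext^(i+1)(X, N)`; the
    -- kernel is finite by noetherianity.
    exact S.moduleCat_prop_of_surjective (exac.extClass.precompOfLinear R N (add_comm 1 i))
      (precomp_extClass_surjective_of_projective_X₂ N exac i)
      (ih (ModuleCat.of R (LinearMap.ker f)))

/-- Modulo a Serre class, `Ext` does not see a submodule in the class. -/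
lemma prop_extModule_iff_of_shortExact [IsNoetherianRing R] (X : ModuleCat.{u} R)
    [Module.Finite R X] {T : ShortComplex (ModuleCat.{u} R)} (hT : T.ShortExact) (h₁ : S T.X₁)
    (i : ℕ) : S (extModule X T.X₂ i) ↔ S (extModule X T.X₃ i) :=
  ⟨fun h ↦ S.moduleCat_prop_of_exact _ _ (exact_postcomp_g_extClass X hT i) h
    (S.prop_extModule X h₁ (i + 1)),
  fun h ↦ S.moduleCat_prop_of_exact _ _ (exact_postcomp_f_g X hT i) (S.prop_extModule X h₁ i) h⟩

open localCohomology

/-- If the local cohomology modules of `M` below degree `n` belong to a Serre class, then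
`Ext^n(R ⧸ 𝔞, M)` belongs to the class if and only if `Hom(R ⧸ 𝔞, H^n_𝔞(M))` does. -/
theorem prop_extModule_iff_prop_hom_extColim [IsNoetherianRing R] (n : ℕ) (M : ModuleCat.{u} R)
    (h : ∀ i < n, S (extColim 𝔞 i M)) :
    S (extModule (ModuleCat.of R (R ⧸ 𝔞)) M n) ↔
      S (extModule (ModuleCat.of R (R ⧸ 𝔞)) (extColim 𝔞 n M) 0) := by
  have hX : powTorsion 𝔞 (ModuleCat.of R (R ⧸ 𝔞)) = ⊤ :=
    powTorsion_quotient_eq_top 𝔞 (pow_one 𝔞).le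
  induction n generalizing M with
  | zero =>
    exact (S.moduleCat_prop_iff (LinearEquiv.ofBijective _
      (extModule_postcomp_bijective_of_torsion hX (extColimZeroTo 𝔞 M)
        (extColimZeroTo_injective M) (range_extColimZeroTo M).ge))).symm
  | succ n ih =>
    have hΓ : S (ModuleCat.of R (powTorsion 𝔞 M)) :=
      (S.moduleCat_prop_iff (extColimZeroEquiv 𝔞 M)).1 (h 0 n.succ_pos)
    have hT : (ModuleCat.shortComplexOfCompEqZero (powTorsion 𝔞 M).subtype
        (powTorsion 𝔞 M).mkQ (LinearMap.exact_subtype_mkQ _).linearMap_comp_eq_zero).ShortExact :=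
      ModuleCat.shortComplex_shortExact _ (LinearMap.exact_subtype_mkQ _)
        (powTorsion 𝔞 M).injective_subtype (Submodule.mkQ_surjective _)
    have h₁ : powTorsion 𝔞 (powTorsion 𝔞 M) = ⊤ := by
      rw [eq_top_iff]
      rintro ⟨x, k, hk⟩ -
      exact ⟨k, fun r hr ↦ Subtype.ext (hk r hr)⟩
    obtain ⟨E, f, hE, hf, hEt⟩ := exists_embedding_of_powTorsion_eq_bot 𝔞 (M ⧸ powTorsion 𝔞 M)
      powTorsion_quotient_powTorsion
    have hU := LinearMap.shortExact_shortComplexCokernel hf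
    -- Pass from `M` to `M/Γ(M)` in degree `i + 1`, then back along the connecting map to the
    -- cokernel in degree `i`.
    have e (i : ℕ) : extColim 𝔞 (i + 1) M ≅ extColim 𝔞 i f.shortComplexCokernel.X₃ :=
      ((LinearEquiv.ofBijective _ (extColimMap_mk₀_g_bijective hT h₁ i)).trans
        (LinearEquiv.ofBijective _ (extColimMap_extClass_bijective hU hEt i)).symm).toModuleIso
    have hC := ih f.shortComplexCokernel.X₃ fun i hi ↦
      (S.prop_iff_of_iso (e i)).1 (h (i + 1) (Nat.succ_lt_succ hi))
    exact (S.prop_extModule_iff_of_shortExact _ hT hΓ (n + 1)).trans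
      ((S.moduleCat_prop_iff (LinearEquiv.ofBijective _
        (extClass_postcomp_bijective hU hEt hX n))).symm.trans
        (hC.trans (S.moduleCat_prop_iff (extModuleCongr _ (e n) 0)).symm))

end CategoryTheory.ObjectProperty

end Serre

/-! ### Weakly Laskerian modules and associated primes. -/

section WeaklyLaskerian

open Opposite Limits Abelian

variable {R : Type u} [CommRing R]

namespace IsWeaklyLaskerian

variable {A B C : Type u} [AddCommGroup A] [Module R A] [AddCommGroup B] [Module R B]
  [AddCommGroup C] [Module R C]

lemma of_subsingleton [Subsingleton A] : IsWeaklyLaskerian R A := fun N ↦ by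
  rw [associatedPrimes.eq_empty_of_subsingleton]
  exact Set.finite_empty

lemma of_surjective (h : IsWeaklyLaskerian R A) (f : A →ₗ[R] B) (hf : Function.Surjective f) :
    IsWeaklyLaskerian R B := fun N ↦ by
  have hs : Function.Surjective (N.mkQ.comp f) := N.mkQ_surjective.comp hf
  rw [← LinearEquiv.AssociatedPrimes.eq ((N.mkQ.comp f).quotKerEquivOfSurjective hs)]
  exact h _

/-- `B/N` is the middle of an exact sequence from `A/f⁻¹(N)`, which injects, to `C/g(N)`; its
associated primes come from these two ends. -/
lemma of_exact (hA : IsWeaklyLaskerian R A) (hC : IsWeaklyLaskerian R C) (f : A →ₗ[R] B)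
    (g : B →ₗ[R] C) (hfg : Function.Exact f g) : IsWeaklyLaskerian R B := fun N ↦ by
  let f' : (A ⧸ N.comap f) →ₗ[R] B ⧸ N := (N.comap f).mapQ N f le_rfl
  let g' : (B ⧸ N) →ₗ[R] C ⧸ N.map g := N.mapQ (N.map g) g (N.le_comap_map g)
  have hf' : Function.Injective f' :=
    LinearMap.ker_eq_bot.1 (by
      rw [eq_bot_iff]
      intro x hx
      obtain ⟨x, rfl⟩ := Submodule.mkQ_surjective _ x
      exact (Submodule.Quotient.mk_eq_zero _).2 ((Submodule.Quotient.mk_eq_zero N).1 hx))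
  have h' : Function.Exact f' g' := by
    intro x
    obtain ⟨b, rfl⟩ := Submodule.mkQ_surjective _ x
    constructor
    · intro hb
      obtain ⟨n, hn, hnb⟩ := (Submodule.Quotient.mk_eq_zero (N.map g)).1 hb
      obtain ⟨a, ha⟩ := (hfg (b - n)).1 (by rw [map_sub, hnb, sub_self])
      refine ⟨Submodule.Quotient.mk a, ?_⟩
      refine (Submodule.Quotient.eq N).2 ?_
      rw [ha, sub_sub_cancel_left]
      exact N.neg_mem hn
    · rintro ⟨a, ha⟩
      obtain ⟨a, rfl⟩ := Submodule.mkQ_surjective _ a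
      rw [← ha]
      change (Submodule.Quotient.mk (g (f a)) : C ⧸ N.map g) = 0
      rw [hfg.apply_apply_eq_zero, Submodule.Quotient.mk_zero]
  exact ((hA _).union (hC _)).subset (associatedPrimes.subset_union_of_exact hf' h')

lemma of_injective (h : IsWeaklyLaskerian R B) (f : A →ₗ[R] B) (hf : Function.Injective f) :
    IsWeaklyLaskerian R A := fun N ↦ by
  refine (h (N.map f)).subset (associatedPrimes.subset_of_injective
    (f := N.mapQ (N.map f) f (N.le_comap_map f)) (LinearMap.ker_eq_bot.1 ?_))
  rw [eq_bot_iff]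
  intro x hx
  obtain ⟨x, rfl⟩ := Submodule.mkQ_surjective _ x
  obtain ⟨n, hn, hnx⟩ := (Submodule.Quotient.mk_eq_zero (N.map f)).1 hx
  rw [hf hnx] at hn
  exact (Submodule.Quotient.mk_eq_zero N).2 hn

lemma associatedPrimes_finite (h : IsWeaklyLaskerian R A) : (associatedPrimes R A).Finite := by
  rw [← LinearEquiv.AssociatedPrimes.eq ((⊥ : Submodule R A).quotEquivOfEqBot rfl)]
  exact h ⊥

end IsWeaklyLaskerian

instance weaklyLaskerian_isSerreClass : (weaklyLaskerian R).IsSerreClass where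
  exists_zero := ⟨ModuleCat.of R PUnit, ModuleCat.isZero_of_subsingleton _,
    IsWeaklyLaskerian.of_subsingleton (A := PUnit)⟩
  prop_of_mono f _ h := h.of_injective f.hom ((ModuleCat.mono_iff_injective f).1 inferInstance)
  prop_of_epi f _ h := h.of_surjective f.hom ((ModuleCat.epi_iff_surjective f).1 inferInstance)
  prop_X₂_of_shortExact {S} hS h₁ h₃ := h₁.of_exact h₃ S.f.hom S.g.hom
    ((ShortComplex.ShortExact.moduleCat_exact_iff_function_exact _).1 hS.exact)

variable {𝔞 : Ideal R}

/-- Every associated prime of a torsion module `Q` is associated to `Hom(R ⧸ 𝔞, Q)`. -/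
lemma associatedPrimes_subset_extModule [IsNoetherianRing R] {Q : ModuleCat.{u} R}
    (hQ : powTorsion 𝔞 Q = ⊤) :
    associatedPrimes R Q ⊆ associatedPrimes R (extModule (ModuleCat.of R (R ⧸ 𝔞)) Q 0) := by
  rw [LinearEquiv.AssociatedPrimes.eq ((Ext.linearEquiv₀ (R := R)).trans
    (ModuleCat.homLinearEquiv (M := ModuleCat.of R (R ⧸ 𝔞)) (N := Q) (S := R)))]
  rintro p hp
  obtain ⟨hp, x, hx⟩ := isAssociatedPrime_iff.1 hp
  obtain ⟨k, hk⟩ : x ∈ powTorsion 𝔞 Q := hQ ▸ Submodule.mem_top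
  have hmem (r : R) : r ∈ p ↔ r • x = 0 := by
    rw [hx, Submodule.mem_colon_singleton, Submodule.mem_bot]
  -- Since `p = ann(x)` contains `𝔞^k` and is prime, it contains `𝔞`, so `1 ↦ x` defines a map on
  -- `R/𝔞`, again with annihilator `p`.
  have hle : 𝔞 ≤ p := hp.le_of_pow_le (n := k) fun r hr ↦ (hmem r).2 (hk r hr)
  let φ : (R ⧸ 𝔞) →ₗ[R] Q := 𝔞.liftQ (LinearMap.toSpanSingleton R Q x) fun r hr ↦
    (hmem r).1 (hle hr)
  refine isAssociatedPrime_iff.2 ⟨hp, φ, ?_⟩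
  ext r
  rw [Submodule.mem_colon_singleton, Submodule.mem_bot, hmem]
  constructor
  · intro hr
    ext
    change r • ((1 : R) • x) = 0
    rw [one_smul, hr]
  · intro hr
    have : r • ((1 : R) • x) = 0 := congr($hr (Submodule.Quotient.mk 1))
    rwa [one_smul] at this

open localCohomology in
lemma powTorsion_localCohomology (i : ℕ) (M : ModuleCat.{u} R) :
    powTorsion 𝔞 ((localCohomology 𝔞 i).obj M) = ⊤ := by
  rw [eq_top_iff]
  intro x _
  have h := map_mem_powTorsion (𝔞 := 𝔞) (isoExtColim 𝔞 i M).inv.hom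
    (exists_forall_smul_eq_zero ((isoExtColim 𝔞 i M).hom x))
  have : (isoExtColim 𝔞 i M).inv.hom ((isoExtColim 𝔞 i M).hom x) = x :=
    congr($((isoExtColim 𝔞 i M).hom_inv_id) x)
  rwa [this] at h

lemma prop_extQuotient_iff (S : ObjectProperty (ModuleCat.{u} R)) [S.IsSerreClass] (i : ℕ)
    (M : ModuleCat.{u} R) :
    S (extQuotient 𝔞 i M) ↔ S (extModule (ModuleCat.of R (R ⧸ 𝔞)) M i) :=
  S.prop_iff_of_iso (extQuotientEquiv 𝔞 i M).toModuleIso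

open localCohomology in
lemma prop_extQuotient_iff_prop_hom_localCohomology [IsNoetherianRing R]
    (S : ObjectProperty (ModuleCat.{u} R)) [S.IsSerreClass] (n : ℕ) (M : ModuleCat.{u} R)
    (h : ∀ i < n, S ((localCohomology 𝔞 i).obj M)) :
    S (extQuotient 𝔞 n M) ↔
      S (extModule (ModuleCat.of R (R ⧸ 𝔞)) ((localCohomology 𝔞 n).obj M) 0) :=
  (prop_extQuotient_iff S n M).trans
    ((S.prop_extModule_iff_prop_hom_extColim n M fun i hi ↦
      (S.prop_iff_of_iso (isoExtColim 𝔞 i M)).1 (h i hi)).trans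
      (S.moduleCat_prop_iff (extModuleCongr _ (isoExtColim 𝔞 n M) 0)).symm)

lemma prop_extQuotient_of_prop_localCohomology [IsNoetherianRing R]
    (S : ObjectProperty (ModuleCat.{u} R)) [S.IsSerreClass] {n : ℕ} {M : ModuleCat.{u} R}
    (h : ∀ i ≤ n, S ((localCohomology 𝔞 i).obj M)) : S (extQuotient 𝔞 n M) :=
  (prop_extQuotient_iff_prop_hom_localCohomology S n M fun i hi ↦ h i hi.le).2
    (S.prop_extModule _ (h n le_rfl) 0)

/-- A torsion module `H` is weakly Laskerian if `Hom(R ⧸ 𝔞, H)` is and all `Ext^1(R ⧸ 𝔞, K)` for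
proper submodules `K` are. -/
lemma weaklyLaskerian_of_torsion [IsNoetherianRing R] {H : ModuleCat.{u} R}
    (hH : powTorsion 𝔞 H = ⊤)
    (h₀ : weaklyLaskerian R (extModule (ModuleCat.of R (R ⧸ 𝔞)) H 0))
    (h₁ : ∀ K : Submodule R H, K ≠ ⊤ → weaklyLaskerian R (extQuotient 𝔞 1 (ModuleCat.of R K))) :
    weaklyLaskerian R H := by
  intro K
  -- The `Ext^1` hypothesis says nothing about `K = ⊤`, but then the quotient is zero.
  by_cases hK : K = ⊤
  · have : Subsingleton (H ⧸ K) := Submodule.Quotient.subsingleton_iff.2 hK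
    rw [associatedPrimes.eq_empty_of_subsingleton]
    exact Set.finite_empty
  have hT : (ModuleCat.shortComplexOfCompEqZero K.subtype K.mkQ
      (LinearMap.exact_subtype_mkQ K).linearMap_comp_eq_zero).ShortExact :=
    ModuleCat.shortComplex_shortExact _ (LinearMap.exact_subtype_mkQ K) K.injective_subtype
      K.mkQ_surjective
  have hQ : powTorsion 𝔞 (H ⧸ K) = ⊤ := by
    rw [eq_top_iff]
    rintro x -
    obtain ⟨x, rfl⟩ := K.mkQ_surjective x
    exact map_mem_powTorsion K.mkQ (hH ▸ Submodule.mem_top)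
  have h : weaklyLaskerian R (extModule (ModuleCat.of R (R ⧸ 𝔞)) (ModuleCat.of R (H ⧸ K)) 0) :=
    (weaklyLaskerian R).moduleCat_prop_of_exact _ _ (exact_postcomp_g_extClass _ hT 0) h₀
      ((prop_extQuotient_iff (weaklyLaskerian R) 1 (ModuleCat.of R K)).1 (h₁ K hK))
  exact (IsWeaklyLaskerian.associatedPrimes_finite h).subset
    (associatedPrimes_subset_extModule (Q := ModuleCat.of R (H ⧸ K)) hQ)

end WeaklyLaskerian

theorem mainTheorem7 {R : Type u} [CommRing R] [IsNoetherianRing R] (𝔞 : Ideal R)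
    (M : ModuleCat.{u} R) (n : ℕ) :
    ((∀ i ≤ n, weaklyLaskerian R ((localCohomology 𝔞 i).obj M)) →
      ∀ i ≤ n, weaklyLaskerian R (extQuotient 𝔞 i M)) ∧
    (∀ S : ObjectProperty (ModuleCat.{u} R), S.IsSerreClass →
      (∀ i ≤ n, S ((localCohomology 𝔞 i).obj M)) → ∀ i ≤ n, S (extQuotient 𝔞 i M)) ∧
    ((∀ i ≤ n, ∀ K : Submodule R ((localCohomology 𝔞 i).obj M), K ≠ ⊤ →
        weaklyLaskerian R (extQuotient 𝔞 1 (ModuleCat.of R K))) →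
      (∀ i ≤ n, weaklyLaskerian R (extQuotient 𝔞 i M)) →
      ∀ i ≤ n, weaklyLaskerian R ((localCohomology 𝔞 i).obj M)) := by
  refine ⟨fun h i hi ↦ prop_extQuotient_of_prop_localCohomology _ fun j hj ↦ h j (hj.trans hi),
    fun S _ h i hi ↦ prop_extQuotient_of_prop_localCohomology S fun j hj ↦ h j (hj.trans hi),
    fun h₁ h i hi ↦ ?_⟩
  -- The equivalence in degree `i` needs all lower local cohomology to be weakly Laskerian already.
  induction i using Nat.strong_induction_on with
  | _ i ih =>
    exact weaklyLaskerian_of_torsion (powTorsion_localCohomology i M)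
      ((prop_extQuotient_iff_prop_hom_localCohomology _ i M fun j hj ↦
        ih j hj (hj.le.trans hi)).1 (h i hi)) (h₁ i hi)
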